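/- Let $Q=Q_1Q_2Q_3Q_4$ be a nondegenerate convex quadrilateral in the plane (regarded as a closed region), with vertices named anticlockwise so that $Q_1Q_3$ is a shortest diagonal. Every $x\in Q$ has a unique representation $x=\sum_i\alpha_iQ_i$ with $\alpha_i\ge 0$, $\sum_i\alpha_i=1$ and $\alpha_2=0$ or $\alpha_4=0$; for a quadrilateral $R=R_1R_2R_3R_4$ inside $Q$ put $P_R(x)=\sum_i\alpha_iR_i$. For $m\ge 2$ let $A=A_1\cup A_2\cup A_3$ be the set of the following $k=(k_1,k_2,k_3,k_4)$ with nonnegative integer entries: $k\in A_1$ if $k_1+k_2+k_3=m-1$, $k_4=0$, $k_2\ne 0$; $k\in A_2$ if $k_1+k_3+k_4=m-1$, $k_2=0$, $k_4\neq 0$; $k\in A_3$ if $k_1+k_3=m-1$, $k_2=k_4=0$. For $k\in A$ put $b=\sum_i k_iQ_i$ and let $S_m(k)=R_1R_2R_3R_4$ with $R_i=\frac1m(b+Q_i)$ for all $i$, except that $R_4=\frac1m(b+Q_1-Q_2+Q_3)$ if $k\in A_1$ and $R_2=\frac1m(b+Q_1+Q_3-Q_4)$ if $k\in A_2$. Let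 $\mathcal S_m=\{S_m(k):k\in A\}$. Let $m\ge 4$, and let $\mathcal W_1\subseteq\mathcal S_m$ be an $m\times m$ quadrilateral labyrinth set, that is: 1. (Tree property) the graph with vertex set $\mathcal W_1$, in which two distinct quadrilaterals are adjacent iff they have a common side, is a tree; 2. (Exit property) there is exactly one $(k_1,k_2,0,0)\in A$ such that $S_m(k_1,k_2,0,0)\in\mathcal W_1$ and $S_m(0,0,k_2,k_1)\in\mathcal W_1$, and exactly one $(k_1,0,0,k_4)\in A$ such that $S_m(k_1,0,0,k_4)\in\mathcal W_1$ and $S_m(0,k_1,k_4,0)\in\mathcal W_1$; 3. (Corner property) $\mathcal W_1$ contains at most one element of $\{S_m(m-1,0,0,0),S_m(0,0,m-1,0)\}$ and at most one element of $\{S_m(0,m-1,0,0),S_m(0,0,0,m-1)\}$. For $n\ge 2$ let $\mathcal W_n=\{P_V(R): V\in\mathcal W_{n-1},\ R\in\mathcal W_1\}$, where $P_V(R)$ is the quadrilateral whose vertices are the images under $P_V$ of the vertices of $R$, in the same order. Let $L_n=\bigcup_{U\in\mathcal W_n}U$ for $n\ge 1$ and $L_\infty=\bigcap_{n\ge 1}L_n$.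 Then $Q\setminus L_\infty$ is nonempty and not path connected. -/

import Mathlib

namespace QuadLabyrinth

/-- The Euclidean plane. -/
abbrev Plane := EuclideanSpace ℝ (Fin 2)

/-- A quadrilateral `R₁R₂R₃R₄`, given by its ordered vertices; `R₁, …, R₄` have indices `0, …, 3`. -/
abbrev Quad := Fin 4 → Plane

/-- The region of the plane covered by a convex quadrilateral. -/
def Quad.region (R : Quad) : Set Plane := convexHull ℝ (Set.range R)

/-- The (undirected) sides of a quadrilateral, each given by its two end points. -/
def Quad.sides (R : Quad) : Set (Sym2 Plane) := {s | ∃ i : Fin 4, s = s(R i, R (i + 1))}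

/-- `det (b - a, c - b)`: positive iff `a`, `b`, `c` make a strict left turn at `b`. -/
def turn (a b c : Plane) : ℝ :=
  (b 0 - a 0) * (c 1 - b 1) - (b 1 - a 1) * (c 0 - b 0)

/-- `Q₁Q₂Q₃Q₄` is a nondegenerate convex quadrilateral whose vertices are named anticlockwise
(a strict left turn at each of the four vertices), starting from an end point of a shortest
diagonal, so that this diagonal is `Q₁Q₃`. -/
structure IsConvexQuad (Q : Quad) : Prop where
  left_turn : ∀ i : Fin 4, 0 < turn (Q i) (Q (i + 1)) (Q (i + 2))
  shortest_diagonal : dist (Q 0) (Q 2) ≤ dist (Q 1) (Q 3)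

/-- `α` is the representation of `x` in `Q`: barycentric coordinates of `x` in one of the triangles
`Q₁Q₂Q₃` (then `α₄ = 0`) and `Q₃Q₄Q₁` (then `α₂ = 0`). For a convex quadrilateral `Q` and a point
`x` of `Q` there is exactly one. -/
structure IsRep (Q : Quad) (x : Plane) (α : Fin 4 → ℝ) : Prop where
  nonneg : ∀ i, 0 ≤ α i
  sum_eq_one : ∑ i, α i = 1
  sum_smul : ∑ i, α i • Q i = x
  triangle : α 1 = 0 ∨ α 3 = 0

/-- The representation of a point of `Q` (a meaningless value outside `Q`). -/
noncomputable def rep (Q : Quad) (x : Plane) : Fin 4 → ℝ := Classical.epsilon (IsRep Q x)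

/-- The map `P_R : Q → R`, `x ↦ ∑ αᵢ Rᵢ`, where `α` is the representation of `x` in `Q`. -/
noncomputable def P (Q R : Quad) (x : Plane) : Plane := ∑ i, rep Q x i • R i

/-- Indices of the cells inside the triangle `Q₁Q₂Q₃`. -/
def A₁ (m : ℕ) : Set (Fin 4 → ℕ) := {k | k 0 + k 1 + k 2 + 1 = m ∧ k 3 = 0 ∧ k 1 ≠ 0}

/-- Indices of the cells inside the triangle `Q₃Q₄Q₁`. -/
def A₂ (m : ℕ) : Set (Fin 4 → ℕ) := {k | k 0 + k 2 + k 3 + 1 = m ∧ k 1 = 0 ∧ k 3 ≠ 0}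

/-- Indices of the cells along the diagonal `Q₁Q₃`. -/
def A₃ (m : ℕ) : Set (Fin 4 → ℕ) := {k | k 0 + k 2 + 1 = m ∧ k 1 = 0 ∧ k 3 = 0}

/-- The index set of the subdivision of `Q` into `m * m` cells. -/
def A (m : ℕ) : Set (Fin 4 → ℕ) := A₁ m ∪ A₂ m ∪ A₃ m

/-- The cell `S_m(k₁,k₂,k₃,k₄)` of `Q`, for `k ∈ A m`. The three cases are `k ∈ A₁ m`, `k ∈ A₂ m`
and `k ∈ A₃ m`. -/
noncomputable def cell (Q : Quad) (m : ℕ) (k : Fin 4 → ℕ) : Quad :=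
  let b : Plane := ∑ i, (k i : ℝ) • Q i
  let c : ℝ := (m : ℝ)⁻¹
  if k 1 ≠ 0 then
    ![c • (b + Q 0), c • (b + Q 1), c • (b + Q 2), c • (b + Q 0 - Q 1 + Q 2)]
  else if k 3 ≠ 0 then
    ![c • (b + Q 0), c • (b + Q 0 + Q 2 - Q 3), c • (b + Q 2), c • (b + Q 3)]
  else
    ![c • (b + Q 0), c • (b + Q 1), c • (b + Q 2), c • (b + Q 3)]

/-- The set `𝒮_m` of all cells of the subdivision. -/
def cells (Q : Quad) (m : ℕ) : Set Quad := cell Q m '' A m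

/-- The graph of a set of white quadrilaterals: two different ones are adjacent iff they have a
common side. -/
def whiteGraph (W : Set Quad) : SimpleGraph W where
  Adj U V := U ≠ V ∧ (U.1.sides ∩ V.1.sides).Nonempty
  symm := ⟨fun _ _ h => ⟨h.1.symm, by rw [Set.inter_comm]; exact h.2⟩⟩
  loopless := ⟨fun _ h => h.1 rfl⟩

/-- `W` is an `m × m` quadrilateral labyrinth set in `Q`. -/
structure IsLabyrinthSet (Q : Quad) (m : ℕ) (W : Set Quad) : Prop where
  four_le : 4 ≤ m
  subset_cells : W ⊆ cells Q m
  tree : (whiteGraph W).IsTree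
  /-- exactly one pair of a left exit and a right exit opposite to it -/
  exit_left_right : ∃! p : ℕ × ℕ, ![p.1, p.2, 0, 0] ∈ A m ∧
    cell Q m ![p.1, p.2, 0, 0] ∈ W ∧ cell Q m ![0, 0, p.2, p.1] ∈ W
  /-- exactly one pair of a top exit and a bottom exit opposite to it -/
  exit_top_bottom : ∃! p : ℕ × ℕ, ![p.1, 0, 0, p.2] ∈ A m ∧
    cell Q m ![p.1, 0, 0, p.2] ∈ W ∧ cell Q m ![0, p.1, p.2, 0] ∈ W
  corner₁₃ : ¬ (cell Q m ![m - 1, 0, 0, 0] ∈ W ∧ cell Q m ![0, 0, m - 1, 0] ∈ W)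
  corner₂₄ : ¬ (cell Q m ![0, m - 1, 0, 0] ∈ W ∧ cell Q m ![0, 0, 0, m - 1] ∈ W)

/-- `white Q W n` is the set `𝒲_{n+1}` of white quadrilaterals of order `n + 1`, where `W = 𝒲₁`;
the image of a quadrilateral under `P_V` is given by the images of its vertices. -/
def white (Q : Quad) (W : Set Quad) : ℕ → Set Quad
  | 0 => W
  | n + 1 => {U | ∃ V ∈ white Q W n, ∃ R ∈ W, U = fun i => P Q V (R i)}

/-- `level Q W n` is the union `L_{n+1}` of the white quadrilaterals of order `n + 1`. -/
def level (Q : Quad) (W : Set Quad) (n : ℕ) : Set Plane := ⋃ U ∈ white Q W n, U.region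

/-- The limit set `L_∞`, the intersection of all `L_n`, `n ≥ 1`. -/
def fractal (Q : Quad) (W : Set Quad) : Set Plane := ⋂ n, level Q W n

end QuadLabyrinth

namespace QuadLabyrinth

/-! Let `chart Q` map the unit square onto `Q`, affinely on each side of the diagonal. It carries
the squares of the `m × m` grid to the cells (`cell_eq_gridSquare`), and `P Q V` composed with it is
`chart V` (`P_chart`). Iterating the maps `P Q V` therefore becomes a substitution in which every
white grid square is replaced by a copy of the white pattern.

Every level of this substitution is connected through sides and has opposite exits in both
directions, because neighbouring copies are glued along opposite exits
(`IsGridLabyrinth.subdivide`). It thus contains a chain from the bottom row to the top row, and a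
path from the left to the right side of the square must meet it
(`IsGridLabyrinth.exists_mem_gridRegion`). The reason is a discrete intersection number: the signed
number of crossings of the chain to the left of a square off the chain does not change between
touching squares, yet it is 0 at the left side and 1 at the right side. The levels are closed and
nested, so by compactness some point of the path lies in all of them, hence in the fractal.
Transposition gives the same for paths from bottom to top.

By the corner property, one of `Q 0`, `Q 2` and one of `Q 1`, `Q 3` lie outside the fractal
(`IsLabyrinthSet.notMem_fractal`). These two are neighbouring vertices of `Q`, so they lie on
opposite sides of the unit square and no path in the complement joins them. -/

/-! ### Crossing numbers of chains of grid squares -/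

/-- Two unit squares of the integer grid, given by their lower left corners, have a common side. -/
def SideAdj (p q : ℕ × ℕ) : Prop :=
  (p.1 = q.1 ∧ (p.2 + 1 = q.2 ∨ q.2 + 1 = p.2)) ∨ (p.2 = q.2 ∧ (p.1 + 1 = q.1 ∨ q.1 + 1 = p.1))

/-- Two grid squares are joined by a chain of squares of `S` in which consecutive squares have a
common side. -/
def Linked (S : Set (ℕ × ℕ)) : ℕ × ℕ → ℕ × ℕ → Prop :=
  Relation.ReflTransGen fun p q => p ∈ S ∧ q ∈ S ∧ SideAdj p q

/-- The signed number of crossings of a chain in `S` from `p` to `q` with the part left of column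
`x` of the line between the rows `y` and `y + 1`. -/
structure IsCrossingNumber (S : Set (ℕ × ℕ)) (N : ℕ) (p q : ℕ × ℕ) (F : ℕ → ℕ → ℤ) : Prop where
  right : ∀ x y, (x, y) ∉ S → F (x + 1) y = F x y
  up : ∀ x y z, (z, y + 1) ∉ S → x = z ∨ x = z + 1 →
    F x y + (if p.2 = y + 1 ∧ p.1 < x then 1 else 0) =
      F x (y + 1) + (if q.2 = y + 1 ∧ q.1 < x then 1 else 0)
  zero : ∀ y, F 0 y = 0
  total : ∀ y, F N y + (if y + 1 ≤ p.2 then 1 else 0) = if y + 1 ≤ q.2 then 1 else 0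

/-- The crossing number of a single step from `p` to `q`. -/
def stepCrossing (p q : ℕ × ℕ) (x y : ℕ) : ℤ :=
  if p.1 < x ∧ p.1 = q.1 ∧ p.2 = y ∧ q.2 = y + 1 then 1
  else if p.1 < x ∧ p.1 = q.1 ∧ p.2 = y + 1 ∧ q.2 = y then -1 else 0

/-- The identities express conservation of flow. What enters the part of row `y + 1` left of column
`x` from below must leave it above, unless the chain starts or ends there: leaving sideways would
use both `(x - 1, y + 1)` and `(x, y + 1)`, and one of them is outside `S`. -/
lemma isCrossingNumber_stepCrossing {S : Set (ℕ × ℕ)} {N : ℕ} (hN : ∀ p ∈ S, p.1 < N)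
    {p q : ℕ × ℕ} (hp : p ∈ S) (hq : q ∈ S) (h : SideAdj p q) :
    IsCrossingNumber S N p q (stepCrossing p q) := by
  have hpN := hN p hp
  obtain ⟨a, b⟩ := p
  obtain ⟨c, d⟩ := q
  simp only at hpN
  refine ⟨fun x y hxy => ?_, fun x y z hxy hz => ?_, fun y => by simp [stepCrossing], fun y => ?_⟩
  · have h1 : ¬ (a = x ∧ b = y) := by rintro ⟨rfl, rfl⟩; exact hxy hp
    have h2 : ¬ (c = x ∧ d = y) := by rintro ⟨rfl, rfl⟩; exact hxy hq
    simp only [stepCrossing]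
    split_ifs <;> omega
  · have h1 : ¬ (a = z ∧ b = y + 1) := by rintro ⟨rfl, rfl⟩; exact hxy hp
    have h2 : ¬ (c = z ∧ d = y + 1) := by rintro ⟨rfl, rfl⟩; exact hxy hq
    clear hp hq hxy hN hpN
    simp only [stepCrossing]
    obtain ⟨h3, h4 | h4⟩ | ⟨h3, h4 | h4⟩ := h <;> simp only at h3 h4 <;> subst h3 <;> subst h4 <;>
      split_ifs <;> omega
  · simp only [stepCrossing]
    obtain ⟨h3, h4 | h4⟩ | ⟨h3, h4 | h4⟩ := h <;> simp only at h3 h4 <;> subst h3 <;> subst h4 <;>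
      split_ifs <;> omega

lemma IsCrossingNumber.add {S : Set (ℕ × ℕ)} {N : ℕ} {p q r : ℕ × ℕ} {F G : ℕ → ℕ → ℤ}
    (hF : IsCrossingNumber S N p q F) (hG : IsCrossingNumber S N q r G) :
    IsCrossingNumber S N p r (fun x y => F x y + G x y) where
  right x y h := by rw [hF.right x y h, hG.right x y h]
  up x y z h hz := by linarith [hF.up x y z h hz, hG.up x y z h hz]
  zero y := by simp [hF.zero, hG.zero]
  total y := by linarith [hF.total y, hG.total y]

lemma Linked.exists_isCrossingNumber {S : Set (ℕ × ℕ)} {N : ℕ} (hN : ∀ p ∈ S, p.1 < N)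
    {p q : ℕ × ℕ} (h : Linked S p q) : ∃ F, IsCrossingNumber S N p q F := by
  induction h with
  | refl => exact ⟨fun _ _ => 0, by simp, by simp, by simp, by simp⟩
  | tail _ hs ih =>
    obtain ⟨F, hF⟩ := ih
    exact ⟨_, hF.add (isCrossingNumber_stepCrossing hN hs.1 hs.2.1 hs.2.2)⟩

/-- The crossing number is the same at squares outside `S` that have a common point, in the rows
that contain no end point of the chain. -/
lemma IsCrossingNumber.eq_of_touching {S : Set (ℕ × ℕ)} {N M : ℕ} {p q : ℕ × ℕ} {F : ℕ → ℕ → ℤ}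
    (hF : IsCrossingNumber S N p q F) (hp : p.2 = 0) (hq : M ≤ q.2) {x y x' y' : ℕ}
    (h : (x, y) ∉ S) (h' : (x', y') ∉ S) (hy : y < M) (hy' : y' < M)
    (hx : x ≤ x' + 1) (hx' : x' ≤ x + 1) (hyy : y ≤ y' + 1) (hyy' : y' ≤ y + 1) :
    F x y = F x' y' := by
  have row : ∀ {x x' y}, (x, y) ∉ S → (x', y) ∉ S → x ≤ x' + 1 → x' ≤ x + 1 → F x y = F x' y := by
    intro x x' y h h' hx hx'
    obtain rfl | rfl | rfl : x = x' ∨ x' = x + 1 ∨ x = x' + 1 := by omega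
    · rfl
    · exact (hF.right _ _ h).symm
    · exact hF.right _ _ h'
  have col : ∀ {x y z}, (z, y + 1) ∉ S → x = z ∨ x = z + 1 → y + 1 < M → F x y = F x (y + 1) := by
    intro x y z h hz hy
    simpa [hp, show q.2 ≠ y + 1 by omega] using hF.up x y z h hz
  -- Squares sharing only a corner must be allowed, since a path can pass through grid points. The
  -- value at such a square is reached by a horizontal and a vertical move, each justified by one of
  -- the two squares outside `S`.
  have diag : ∀ {x x' y}, (x, y) ∉ S → (x', y + 1) ∉ S → y + 1 < M → x ≤ x' + 1 → x' ≤ x + 1 →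
      F x y = F x' (y + 1) := by
    intro x x' y h h' hy hx hx'
    obtain rfl | rfl | rfl : x = x' ∨ x' = x + 1 ∨ x = x' + 1 := by omega
    · exact col h' (.inl rfl) hy
    · rw [← col h' (.inl rfl) hy, hF.right _ _ h]
    · rw [col h' (.inr rfl) hy, hF.right _ _ h']
  obtain rfl | rfl | rfl : y = y' ∨ y' = y + 1 ∨ y = y' + 1 := by omega
  · exact row h h' hx hx'
  · exact diag h h' hy' hx hx'
  · exact (diag h' h hy hx' hx).symm

/-! ### Grid labyrinths and their subdivision -/

/-- A set of squares of the `m × m` grid that is connected through common sides and contains two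
opposite squares both of the bottom and top rows and of the left and right columns. -/
structure IsGridLabyrinth (m : ℕ) (S : Set (ℕ × ℕ)) : Prop where
  lt : ∀ p ∈ S, p.1 < m ∧ p.2 < m
  linked : ∀ p ∈ S, ∀ q ∈ S, Linked S p q
  exit_bottom_top : ∃ c, (c, 0) ∈ S ∧ (c, m - 1) ∈ S
  exit_left_right : ∃ r, (0, r) ∈ S ∧ (m - 1, r) ∈ S

/-- Each square of `T` is replaced by a copy of the pattern `S` of squares of the `m × m` grid. -/
def subdivide (m : ℕ) (T S : Set (ℕ × ℕ)) : Set (ℕ × ℕ) :=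
  {p | ∃ v ∈ T, ∃ r ∈ S, p = (v.1 * m + r.1, v.2 * m + r.2)}

/-- The pattern `S` after `n` subdivisions. -/
def gridLevel (m : ℕ) (S : Set (ℕ × ℕ)) : ℕ → Set (ℕ × ℕ)
  | 0 => S
  | n + 1 => subdivide m (gridLevel m S n) S

lemma SideAdj.swap {p q : ℕ × ℕ} (h : SideAdj p q) : SideAdj p.swap q.swap := by
  simp only [SideAdj, Prod.fst_swap, Prod.snd_swap] at h ⊢
  exact h.symm

lemma Linked.swap {S : Set (ℕ × ℕ)} {p q : ℕ × ℕ} (h : Linked S p q) :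
    Linked (Prod.swap ⁻¹' S) p.swap q.swap :=
  Relation.ReflTransGen.lift Prod.swap (fun _ _ h => ⟨by simpa using h.1, by simpa using h.2.1,
    h.2.2.swap⟩) _ _ h

/-- Transposition exchanges the two exit conditions; this reduces paths from bottom to top to paths
from left to right. -/
lemma IsGridLabyrinth.swap {m : ℕ} {S : Set (ℕ × ℕ)} (h : IsGridLabyrinth m S) :
    IsGridLabyrinth m (Prod.swap ⁻¹' S) where
  lt p hp := (h.lt _ hp).symm
  linked p hp q hq := by simpa using (h.linked _ hp _ hq).swap
  exit_bottom_top := h.exit_left_right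
  exit_left_right := h.exit_bottom_top

lemma gridLevel_swap (m : ℕ) (S : Set (ℕ × ℕ)) (n : ℕ) :
    gridLevel m (Prod.swap ⁻¹' S) n = Prod.swap ⁻¹' gridLevel m S n := by
  induction n with
  | zero => rfl
  | succ n ih =>
    ext ⟨a, b⟩
    simp only [gridLevel, ih, subdivide, Set.mem_preimage, Set.mem_ofPred_eq, Prod.exists,
      Prod.swap_prod_mk, Prod.mk.injEq]
    constructor
    · rintro ⟨v, w, h, r, s, h', rfl, rfl⟩
      exact ⟨w, v, h, s, r, h', rfl, rfl⟩
    · rintro ⟨v, w, h, r, s, h', rfl, rfl⟩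
      exact ⟨w, v, h, s, r, h', rfl, rfl⟩

/-- Each copy of `S` is linked in itself. Copies in neighbouring squares of `T` have a common side
at a pair of opposite exits: the top exit of the lower one lies below the bottom exit of the upper
one, and likewise for left and right. -/
lemma Linked.subdivide {m : ℕ} {T S : Set (ℕ × ℕ)} (hS : IsGridLabyrinth m S) {v w : ℕ × ℕ}
    (h : Linked T v w) (hv : v ∈ T) {r s : ℕ × ℕ} (hr : r ∈ S) (hs : s ∈ S) :
    Linked (subdivide m T S) (v.1 * m + r.1, v.2 * m + r.2) (w.1 * m + s.1, w.2 * m + s.2) := by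
  have inner : ∀ {v}, v ∈ T → ∀ {r s}, r ∈ S → s ∈ S →
      Linked (QuadLabyrinth.subdivide m T S) (v.1 * m + r.1, v.2 * m + r.2)
        (v.1 * m + s.1, v.2 * m + s.2) := by
    intro v hv r s hr hs
    refine Relation.ReflTransGen.lift (fun r : ℕ × ℕ => (v.1 * m + r.1, v.2 * m + r.2))
      (fun p q h => ⟨⟨v, hv, p, h.1, rfl⟩, ⟨v, hv, q, h.2.1, rfl⟩, ?_⟩) _ _ (hS.linked r hr s hs)
    have := h.2.2
    simp only [SideAdj] at this ⊢
    omega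
  induction h generalizing s with
  | refl => exact inner hv hr hs
  | @tail w z _ hstep ih =>
    obtain ⟨hw, hz, hadj⟩ := hstep
    obtain ⟨c, hc, hc'⟩ := hS.exit_bottom_top
    obtain ⟨e, he, he'⟩ := hS.exit_left_right
    have hm : 0 < m := by have := hS.lt _ hs; omega
    have next : ∀ {a b}, a ∈ S → b ∈ S →
        SideAdj (w.1 * m + a.1, w.2 * m + a.2) (z.1 * m + b.1, z.2 * m + b.2) →
        Linked (QuadLabyrinth.subdivide m T S) (v.1 * m + r.1, v.2 * m + r.2)
          (z.1 * m + s.1, z.2 * m + s.2) := fun {a b} ha hb hab =>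
      ((ih ha).tail ⟨⟨w, hw, a, ha, rfl⟩, ⟨z, hz, b, hb, rfl⟩, hab⟩).trans (inner hz hb hs)
    obtain ⟨h1, h2 | h2⟩ | ⟨h1, h2 | h2⟩ := hadj
    · refine next hc' hc (.inl ⟨by simp [h1], .inl ?_⟩)
      simp only [← h2, add_mul]; omega
    · refine next hc hc' (.inl ⟨by simp [h1], .inr ?_⟩)
      simp only [← h2, add_mul]; omega
    · refine next he' he (.inr ⟨by simp [h1], .inl ?_⟩)
      simp only [← h2, add_mul]; omega
    · refine next he he' (.inr ⟨by simp [h1], .inr ?_⟩)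
      simp only [← h2, add_mul]; omega

lemma IsGridLabyrinth.subdivide {M m : ℕ} {T S : Set (ℕ × ℕ)} (hT : IsGridLabyrinth M T)
    (hS : IsGridLabyrinth m S) : IsGridLabyrinth (M * m) (subdivide m T S) where
  lt := by
    rintro _ ⟨v, hv, r, hr, rfl⟩
    have h1 := hT.lt v hv
    have h2 := hS.lt r hr
    exact ⟨by nlinarith, by nlinarith⟩
  linked := by
    rintro _ ⟨v, hv, r, hr, rfl⟩ _ ⟨w, hw, s, hs, rfl⟩
    exact (hT.linked v hv w hw).subdivide hS hv hr hs
  exit_bottom_top := by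
    obtain ⟨c, hc, hc'⟩ := hT.exit_bottom_top
    obtain ⟨e, he, he'⟩ := hS.exit_bottom_top
    refine ⟨c * m + e, ⟨_, hc, _, he, by simp⟩, ⟨_, hc', _, he', ?_⟩⟩
    obtain ⟨M, rfl⟩ := Nat.exists_eq_add_of_lt (hT.lt _ hc).2
    have := (hS.lt _ he).2
    simp only [Prod.mk.injEq, true_and, zero_add, Nat.add_sub_cancel, add_mul]
    omega
  exit_left_right := by
    obtain ⟨c, hc, hc'⟩ := hT.exit_left_right
    obtain ⟨e, he, he'⟩ := hS.exit_left_right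
    refine ⟨c * m + e, ⟨_, hc, _, he, by simp⟩, ⟨_, hc', _, he', ?_⟩⟩
    obtain ⟨M, rfl⟩ := Nat.exists_eq_add_of_lt (hT.lt _ hc).1
    have := (hS.lt _ he).1
    simp only [Prod.mk.injEq, and_true, zero_add, Nat.add_sub_cancel, add_mul]
    omega

lemma IsGridLabyrinth.gridLevel {m : ℕ} {S : Set (ℕ × ℕ)} (h : IsGridLabyrinth m S) (n : ℕ) :
    IsGridLabyrinth (m ^ (n + 1)) (gridLevel m S n) := by
  induction n with
  | zero => simpa [QuadLabyrinth.gridLevel] using h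
  | succ n ih => rw [pow_succ]; exact ih.subdivide h

/-! ### Paths across the unit square -/

/-- The closed region covered by a set of squares of the `N × N` grid of the unit square. -/
def gridRegion (N : ℕ) (T : Set (ℕ × ℕ)) : Set (ℝ × ℝ) :=
  ⋃ p ∈ T, {s | (p.1 ≤ N * s.1 ∧ N * s.1 ≤ p.1 + 1) ∧ (p.2 ≤ N * s.2 ∧ N * s.2 ≤ p.2 + 1)}

lemma isClosed_gridRegion (N : ℕ) {T : Set (ℕ × ℕ)} (hT : T.Finite) :
    IsClosed (gridRegion N T) := by
  refine hT.isClosed_biUnion fun p _ => IsClosed.and (IsClosed.and ?_ ?_) (IsClosed.and ?_ ?_)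
  all_goals exact isClosed_le (by fun_prop) (by fun_prop)

lemma IsGridLabyrinth.finite {m : ℕ} {S : Set (ℕ × ℕ)} (h : IsGridLabyrinth m S) : S.Finite :=
  ((Set.finite_lt_nat m).prod (Set.finite_lt_nat m)).subset fun p hp => h.lt p hp

lemma gridRegion_subdivide_subset {M m : ℕ} {T S : Set (ℕ × ℕ)} (hS : IsGridLabyrinth m S) :
    gridRegion (M * m) (subdivide m T S) ⊆ gridRegion M T := by
  intro s hs
  simp only [gridRegion, Set.mem_iUnion, Set.mem_ofPred_eq] at hs ⊢
  obtain ⟨_, ⟨v, hv, r, hr, rfl⟩, ⟨h1, h2⟩, h3, h4⟩ := hs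
  obtain ⟨hr1, hr2⟩ := hS.lt r hr
  have hm : (0 : ℝ) < m := by exact_mod_cast (Nat.zero_le _).trans_lt hr1
  have hr1 : (r.1 : ℝ) + 1 ≤ m := by exact_mod_cast hr1
  have hr2 : (r.2 : ℝ) + 1 ≤ m := by exact_mod_cast hr2
  have hr3 : (0 : ℝ) ≤ r.1 := Nat.cast_nonneg _
  have hr4 : (0 : ℝ) ≤ r.2 := Nat.cast_nonneg _
  push_cast at h1 h2 h3 h4
  refine ⟨v, hv, ⟨?_, ?_⟩, ?_, ?_⟩ <;> refine le_of_mul_le_mul_right ?_ hm <;> nlinarith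

lemma exists_mem_Icc_nat {N : ℕ} (hN : 0 < N) {a : ℝ} (h0 : 0 ≤ a) (h1 : a ≤ N) :
    ∃ i < N, (i : ℝ) ≤ a ∧ a ≤ i + 1 := by
  -- At the end point `a = N` the floor would leave the grid, so the last interval is taken.
  rcases lt_or_eq_of_le h1 with h | h
  · exact ⟨⌊a⌋₊, (Nat.floor_lt h0).2 h, Nat.floor_le h0, (Nat.lt_floor_add_one a).le⟩
  · refine ⟨N - 1, by omega, ?_, ?_⟩ <;> rw [h, Nat.cast_sub hN] <;> simp

/-- A path in the unit square from the left to the right side meets every grid labyrinth. -/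
lemma IsGridLabyrinth.exists_mem_gridRegion {N : ℕ} {T : Set (ℕ × ℕ)} (hT : IsGridLabyrinth N T)
    {f : unitInterval → ℝ × ℝ} (hf : Continuous f)
    (hmem : ∀ t, f t ∈ Set.Icc (0 : ℝ) 1 ×ˢ Set.Icc (0 : ℝ) 1)
    (h0 : (f 0).1 = 0) (h1 : (f 1).1 = 1) : ∃ t, f t ∈ gridRegion N T := by
  by_contra! hcon
  obtain ⟨c, hc, hc'⟩ := hT.exit_bottom_top
  obtain ⟨hcN, hN⟩ := hT.lt _ hc
  simp only at hcN hN
  have hN' : (0 : ℝ) < N := by exact_mod_cast hN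
  -- the chain from the bottom row to the top row, prolonged by one square above the grid
  have hlink : Linked (insert (c, N) T) (c, 0) (c, N) :=
    (Relation.ReflTransGen.mono (fun _ _ h => ⟨.inr h.1, .inr h.2.1, h.2.2⟩) _ _
      (hT.linked _ hc _ hc')).tail
      ⟨.inr hc', .inl rfl, .inl ⟨rfl, .inl (by simp only; omega)⟩⟩
  obtain ⟨F, hF⟩ := hlink.exists_isCrossingNumber (N := N)
    (by rintro p (rfl | hp); exacts [hcN, (hT.lt p hp).1])
  have hcell : ∀ t, ∃ i < N, ∃ j < N, ((i : ℝ) ≤ N * (f t).1 ∧ N * (f t).1 ≤ i + 1) ∧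
      ((j : ℝ) ≤ N * (f t).2 ∧ N * (f t).2 ≤ j + 1) := by
    intro t
    obtain ⟨⟨a, b⟩, c, d⟩ := hmem t
    obtain ⟨i, hi, hi'⟩ := exists_mem_Icc_nat hN (a := N * (f t).1) (by positivity) (by nlinarith)
    obtain ⟨j, hj, hj'⟩ := exists_mem_Icc_nat hN (a := N * (f t).2) (by positivity) (by nlinarith)
    exact ⟨i, hi, j, hj, hi', hj'⟩
  choose i hi j hj hI hJ using hcell
  have hblack : ∀ t, (i t, j t) ∉ insert (c, N) T := by
    rintro t (h | h)
    · have := hj t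
      simp only [Prod.mk.injEq] at h
      omega
    · exact hcon t (Set.mem_biUnion h ⟨hI t, hJ t⟩)
  -- The chosen square `(i t, j t)` may jump with `t`, but points at distance less than `1 / N` have
  -- touching squares, and the crossing number does not see such jumps.
  have hloc : IsLocallyConstant fun t => F (i t) (j t) := by
    rw [IsLocallyConstant.iff_eventually_eq]
    intro t
    filter_upwards [hf.continuousAt.eventually (Metric.ball_mem_nhds (f t) (inv_pos.2 hN'))] with s hs
    rw [Prod.dist_eq, max_lt_iff, Real.dist_eq, Real.dist_eq, abs_lt, abs_lt] at hs
    have key : ∀ {x y : ℝ} {a b : ℕ}, (a : ℝ) ≤ N * x → N * y ≤ b + 1 → x - y < (N : ℝ)⁻¹ →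
        a ≤ b + 1 := by
      intro x y a b ha hb hxy
      have h1 : N * (x - y) < 1 := by
        have := mul_lt_mul_of_pos_left hxy hN'
        rwa [mul_inv_cancel₀ hN'.ne'] at this
      have : (a : ℝ) < b + 2 := by linarith
      have : a < b + 2 := by exact_mod_cast this
      omega
    refine hF.eq_of_touching (M := N) rfl le_rfl (hblack s) (hblack t) (hj s) (hj t) ?_ ?_ ?_ ?_
    · exact key (hI s).1 (hI t).2 hs.1.2
    · exact key (hI t).1 (hI s).2 (by linarith [hs.1.1])
    · exact key (hJ s).1 (hJ t).2 hs.2.2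
    · exact key (hJ t).1 (hJ s).2 (by linarith [hs.2.1])
  have heq : F (i 0) (j 0) = F (i 1) (j 1) := hloc.apply_eq_of_preconnectedSpace 0 1
  have hi0 : i 0 = 0 := by
    have := (hI 0).1
    rw [h0, mul_zero] at this
    exact_mod_cast le_antisymm this (Nat.cast_nonneg _)
  have hi1 : i 1 + 1 = N := by
    have := (hI 1).2
    rw [h1, mul_one] at this
    have : N ≤ i 1 + 1 := by exact_mod_cast this
    have := hi 1
    omega
  -- The end of the path is in the last column, in a row below the extra square in row `N`, so the
  -- crossing number there is the total, 1. By constancy it equals the value 0 in column 0.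
  have htot := hF.total (j 1)
  rw [← hi1, hF.right _ _ (hblack 1), ← heq, hi0, hF.zero, hi1] at htot
  have := hj 1
  simp [show j 1 + 1 ≤ N by omega] at htot

lemma IsGridLabyrinth.exists_forall_mem_gridRegion {m : ℕ} {S : Set (ℕ × ℕ)}
    (hS : IsGridLabyrinth m S) {f : unitInterval → ℝ × ℝ} (hf : Continuous f)
    (hmem : ∀ t, f t ∈ Set.Icc (0 : ℝ) 1 ×ˢ Set.Icc (0 : ℝ) 1)
    (h0 : (f 0).1 = 0) (h1 : (f 1).1 = 1) :
    ∃ t, ∀ n, f t ∈ gridRegion (m ^ (n + 1)) (QuadLabyrinth.gridLevel m S n) := by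
  have hclosed : ∀ n, IsClosed (f ⁻¹' gridRegion (m ^ (n + 1)) (QuadLabyrinth.gridLevel m S n)) :=
    fun n => (isClosed_gridRegion _ (hS.gridLevel n).finite).preimage hf
  -- The parameters that hit the successive levels form a decreasing sequence of nonempty compact
  -- sets.
  obtain ⟨t, ht⟩ := IsCompact.nonempty_iInter_of_sequence_nonempty_isCompact_isClosed
    (fun n => f ⁻¹' gridRegion (m ^ (n + 1)) (QuadLabyrinth.gridLevel m S n))
    (fun n => Set.preimage_mono (by rw [pow_succ _ (n + 1)]; exact gridRegion_subdivide_subset hS))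
    (fun n => (hS.gridLevel n).exists_mem_gridRegion hf hmem h0 h1)
    (hclosed 0).isCompact hclosed
  exact ⟨t, fun n => Set.mem_iInter.1 ht n⟩

/-- The same for a path from the bottom to the top side. -/
lemma IsGridLabyrinth.exists_forall_mem_gridRegion_of_snd {m : ℕ} {S : Set (ℕ × ℕ)}
    (hS : IsGridLabyrinth m S) {f : unitInterval → ℝ × ℝ} (hf : Continuous f)
    (hmem : ∀ t, f t ∈ Set.Icc (0 : ℝ) 1 ×ˢ Set.Icc (0 : ℝ) 1)
    (h0 : (f 0).2 = 0) (h1 : (f 1).2 = 1) :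
    ∃ t, ∀ n, f t ∈ gridRegion (m ^ (n + 1)) (QuadLabyrinth.gridLevel m S n) := by
  obtain ⟨t, ht⟩ := hS.swap.exists_forall_mem_gridRegion (f := fun t => (f t).swap)
    (continuous_swap.comp hf) (fun t => (hmem t).symm) h0 h1
  refine ⟨t, fun n => ?_⟩
  have := ht n
  simp only [gridRegion, gridLevel_swap, Set.mem_iUnion, Set.mem_ofPred_eq] at this ⊢
  obtain ⟨p, hp, hx, hy⟩ := this
  exact ⟨p.swap, hp, hy, hx⟩


/-! ### The chart from the unit square to a quadrilateral -/

/-- The representation of the point that corresponds to the point `s` of the unit square. -/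
def squareRep (s : ℝ × ℝ) : Fin 4 → ℝ :=
  ![1 - max s.1 s.2, max (s.1 - s.2) 0, min s.1 s.2, max (s.2 - s.1) 0]

/-- The map of the unit square onto a quadrilateral `R` that is affine on the two triangles
below and above the diagonal and maps the vertices of the square to those of `R`. -/
noncomputable def chart (R : Quad) (s : ℝ × ℝ) : Plane := ∑ i, squareRep s i • R i

/-- The inverse of `chart R`. -/
noncomputable def unchart (R : Quad) (x : Plane) : ℝ × ℝ :=
  let α₁ := max (-turn (R 0) (R 2) x) 0 / turn (R 0) (R 1) (R 2)
  let α₃ := max (turn (R 0) (R 2) x) 0 / turn (R 0) (R 2) (R 3)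
  let α₂ := (turn (R 0) (R 1) x - α₃ * turn (R 0) (R 1) (R 3)) / turn (R 0) (R 1) (R 2)
  (α₁ + α₂, α₂ + α₃)

lemma continuous_unchart (R : Quad) : Continuous (unchart R) := by
  unfold unchart turn
  fun_prop

lemma turn_sum (a b : Plane) (R : Quad) {α : Fin 4 → ℝ} (h : ∑ i, α i = 1) :
    turn a b (∑ i, α i • R i) = ∑ i, α i * turn a b (R i) := by
  simp only [Fin.sum_univ_four] at h ⊢
  have h0 : α 0 = 1 - α 1 - α 2 - α 3 := by linarith
  simp only [turn, PiLp.add_apply, PiLp.smul_apply, smul_eq_mul, h0]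
  ring

lemma turn_rotate (a b c : Plane) : turn b c a = turn a b c := by
  simp only [turn]; ring

lemma turn_swap (a b c : Plane) : turn a c b = -turn a b c := by
  simp only [turn]; ring

lemma turn_self (a b : Plane) : turn a b a = 0 := by
  simp only [turn]; ring

lemma turn_self_right (a b : Plane) : turn a b b = 0 := by
  simp only [turn]; ring

lemma IsConvexQuad.turn_pos {Q : Quad} (hQ : IsConvexQuad Q) :
    0 < turn (Q 0) (Q 1) (Q 2) ∧ 0 < turn (Q 1) (Q 2) (Q 3) ∧ 0 < turn (Q 0) (Q 2) (Q 3) ∧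
      0 < turn (Q 0) (Q 1) (Q 3) := by
  refine ⟨hQ.left_turn 0, hQ.left_turn 1, ?_, ?_⟩
  · rw [← turn_rotate]; exact hQ.left_turn 2
  · rw [← turn_rotate, ← turn_rotate]; exact hQ.left_turn 3

lemma squareRep_nonneg {s : ℝ × ℝ} (hs : s ∈ Set.Icc (0 : ℝ) 1 ×ˢ Set.Icc (0 : ℝ) 1) (i : Fin 4) :
    0 ≤ squareRep s i := by
  obtain ⟨⟨h1, h2⟩, h3, h4⟩ := hs
  fin_cases i <;> simp [squareRep, h1, h2, h3, h4]

lemma sum_squareRep (s : ℝ × ℝ) : ∑ i, squareRep s i = 1 := by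
  simp only [squareRep, Fin.sum_univ_four, Matrix.cons_val]
  rcases le_total s.1 s.2 with h | h <;> simp [h]

lemma isRep_chart {Q : Quad} {s : ℝ × ℝ} (hs : s ∈ Set.Icc (0 : ℝ) 1 ×ˢ Set.Icc (0 : ℝ) 1) :
    IsRep Q (chart Q s) (squareRep s) where
  nonneg := squareRep_nonneg hs
  sum_eq_one := sum_squareRep s
  sum_smul := rfl
  triangle := by
    rcases le_total s.1 s.2 with h | h <;> simp [squareRep, h]

/-- The sign of `turn (Q 0) (Q 2) x` tells the triangle, its size gives the coefficient of `Q 1` or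
`Q 3`, and `turn (Q 0) (Q 1) x` then gives that of `Q 2`. In particular the representation is
unique. -/
lemma IsRep.unchart_eq {Q : Quad} (hQ : IsConvexQuad Q) {x : Plane} {α : Fin 4 → ℝ}
    (h : IsRep Q x α) : unchart Q x = (α 1 + α 2, α 2 + α 3) := by
  obtain ⟨h012, -, h023, h013⟩ := hQ.turn_pos
  have e1 := turn_sum (Q 0) (Q 2) Q h.sum_eq_one
  have e2 := turn_sum (Q 0) (Q 1) Q h.sum_eq_one
  simp only [h.sum_smul, Fin.sum_univ_four, turn_self, turn_self_right,
    turn_swap (Q 0) (Q 1) (Q 2)] at e1 e2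
  have n1 := h.nonneg 1
  have n3 := h.nonneg 3
  rcases h.triangle with h0 | h0
  · have p3 : 0 ≤ α 3 * turn (Q 0) (Q 2) (Q 3) := by positivity
    simp only [h0, zero_mul, zero_add, mul_zero, add_zero] at e1 e2
    simp only [unchart, e1, e2, max_eq_left p3, max_eq_right (neg_nonpos.2 p3), h0]
    simp only [Prod.mk.injEq]
    constructor <;> field_simp <;> ring
  · have p1 : 0 ≤ α 1 * turn (Q 0) (Q 1) (Q 2) := by positivity
    simp only [h0, zero_mul, zero_add, mul_zero, add_zero, mul_neg] at e1 e2
    simp only [unchart, e1, e2, neg_neg, max_eq_left p1, max_eq_right (neg_nonpos.2 p1), h0]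
    simp only [Prod.mk.injEq]
    constructor <;> field_simp <;> ring

lemma IsRep.eq_squareRep {Q : Quad} (hQ : IsConvexQuad Q) {x : Plane} {α : Fin 4 → ℝ}
    (h : IsRep Q x α) : α = squareRep (unchart Q x) := by
  have hsum := h.sum_eq_one
  rw [Fin.sum_univ_four] at hsum
  have n1 := h.nonneg 1
  have n3 := h.nonneg 3
  rw [h.unchart_eq hQ]
  ext i
  rcases h.triangle with h0 | h0
  · have : α 2 ≤ α 2 + α 3 := by linarith
    fin_cases i <;> simp [squareRep, h0, n3]; linarith
  · have : α 2 ≤ α 1 + α 2 := by linarith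
    fin_cases i <;> simp [squareRep, h0, n1]; linarith

lemma IsRep.chart_unchart {Q : Quad} (hQ : IsConvexQuad Q) {x : Plane} {α : Fin 4 → ℝ}
    (h : IsRep Q x α) : chart Q (unchart Q x) = x := by
  rw [chart, ← h.eq_squareRep hQ, h.sum_smul]

lemma IsRep.unchart_mem {Q : Quad} (hQ : IsConvexQuad Q) {x : Plane} {α : Fin 4 → ℝ}
    (h : IsRep Q x α) :
    unchart Q x ∈ Set.Icc (0 : ℝ) 1 ×ˢ Set.Icc (0 : ℝ) 1 := by
  have hsum := h.sum_eq_one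
  rw [Fin.sum_univ_four] at hsum
  have n0 := h.nonneg 0
  have n1 := h.nonneg 1
  have n2 := h.nonneg 2
  have n3 := h.nonneg 3
  rw [h.unchart_eq hQ]
  exact ⟨⟨by positivity, by simp only; linarith⟩, ⟨by positivity, by simp only; linarith⟩⟩

lemma unchart_chart {Q : Quad} (hQ : IsConvexQuad Q) {s : ℝ × ℝ}
    (hs : s ∈ Set.Icc (0 : ℝ) 1 ×ˢ Set.Icc (0 : ℝ) 1) :
    unchart Q (chart Q s) = s := by
  rw [(isRep_chart hs).unchart_eq hQ]
  ext <;> rcases le_total s.1 s.2 with h | h <;> simp [squareRep, h]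

/-- By uniqueness the chosen `rep` is `squareRep`, so in the chart `P Q R` only replaces the
vertices of `Q` by those of `R`. -/
lemma P_chart {Q : Quad} (hQ : IsConvexQuad Q) (R : Quad) {s : ℝ × ℝ}
    (hs : s ∈ Set.Icc (0 : ℝ) 1 ×ˢ Set.Icc (0 : ℝ) 1) :
    P Q R (chart Q s) = chart R s := by
  have h : IsRep Q (chart Q s) (rep Q (chart Q s)) := Classical.epsilon_spec ⟨_, isRep_chart hs⟩
  rw [P, h.eq_squareRep hQ, unchart_chart hQ hs, chart]

lemma sum_smul_mem_region (R : Quad) {α : Fin 4 → ℝ} (h0 : ∀ i, 0 ≤ α i) (h1 : ∑ i, α i = 1) :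
    ∑ i, α i • R i ∈ R.region :=
  (convex_convexHull ℝ _).sum_mem (fun i _ => h0 i) h1
    fun i _ => subset_convexHull ℝ _ (Set.mem_range_self i)

lemma exists_of_mem_region {R : Quad} {x : Plane} (h : x ∈ R.region) :
    ∃ α : Fin 4 → ℝ, (∀ i, 0 ≤ α i) ∧ ∑ i, α i = 1 ∧ ∑ i, α i • R i = x := by
  have hconv : Convex ℝ ((fun α : Fin 4 → ℝ => ∑ i, α i • R i) '' stdSimplex ℝ (Fin 4)) := by
    refine (convex_stdSimplex ℝ (Fin 4)).is_linear_image ⟨fun α β => ?_, fun c α => ?_⟩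
    · simp [add_smul, Finset.sum_add_distrib]
    · simp [mul_smul, Finset.smul_sum]
  obtain ⟨α, hα, rfl⟩ := convexHull_min (Set.range_subset_iff.2 fun i => by
    exact ⟨Pi.single i 1, single_mem_stdSimplex ℝ i, by simp [Pi.single_apply, ite_smul]⟩) hconv h
  exact ⟨α, hα.1, hα.2, rfl⟩

/-- The four vertices satisfy one affine relation, whose coefficients are turns, positive at `Q 0`,
`Q 2` and negative at `Q 1`, `Q 3`. Adding the largest multiple that keeps all coefficients
nonnegative makes that of `Q 1` or of `Q 3` vanish. -/
lemma exists_isRep {Q : Quad} (hQ : IsConvexQuad Q) {x : Plane} (hx : x ∈ Q.region) :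
    ∃ α, IsRep Q x α := by
  obtain ⟨β, h0, h1, rfl⟩ := exists_of_mem_region hx
  obtain ⟨h012, h123, h023, h013⟩ := hQ.turn_pos
  set t := min (β 1 / turn (Q 0) (Q 2) (Q 3)) (β 3 / turn (Q 0) (Q 1) (Q 2)) with ht
  have ht0 : 0 ≤ t := le_min (div_nonneg (h0 1) h023.le) (div_nonneg (h0 3) h012.le)
  have ht1 : t * turn (Q 0) (Q 2) (Q 3) ≤ β 1 := (le_div_iff₀ h023).1 (min_le_left _ _)
  have ht3 : t * turn (Q 0) (Q 1) (Q 2) ≤ β 3 := (le_div_iff₀ h012).1 (min_le_right _ _)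
  refine ⟨![β 0 + t * turn (Q 1) (Q 2) (Q 3), β 1 - t * turn (Q 0) (Q 2) (Q 3),
    β 2 + t * turn (Q 0) (Q 1) (Q 3), β 3 - t * turn (Q 0) (Q 1) (Q 2)], ?_, ?_, ?_, ?_⟩
  · intro i
    fin_cases i
    · exact add_nonneg (h0 0) (by positivity)
    · exact sub_nonneg.2 ht1
    · exact add_nonneg (h0 2) (by positivity)
    · exact sub_nonneg.2 ht3
  · rw [Fin.sum_univ_four] at h1 ⊢
    simp only [Matrix.cons_val]
    rw [← h1]
    simp only [turn]; ring
  · ext i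
    simp only [Fin.sum_univ_four, Matrix.cons_val, PiLp.add_apply, PiLp.smul_apply, smul_eq_mul]
    clear_value t
    fin_cases i <;> simp only [turn, Fin.zero_eta, Fin.mk_one] <;> ring
  · simp only [Matrix.cons_val]
    rcases min_choice (β 1 / turn (Q 0) (Q 2) (Q 3)) (β 3 / turn (Q 0) (Q 1) (Q 2)) with h | h
    · left; rw [ht, h]; field_simp; ring
    · right; rw [ht, h]; field_simp; ring

/-! ### Cells and white quadrilaterals as images of grid squares -/

/-- The vertices of the unit square of the integer grid with lower left corner `p`. -/
def gridVertex (p : ℕ × ℕ) (i : Fin 4) : ℕ × ℕ := (p.1 + ![0, 1, 1, 0] i, p.2 + ![0, 0, 1, 1] i)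

/-- The image under `chart Q` of a square of the `N × N` grid of the unit square. -/
noncomputable def gridSquare (Q : Quad) (N : ℕ) (p : ℕ × ℕ) : Quad := fun i =>
  chart Q ((gridVertex p i).1 / N, (gridVertex p i).2 / N)

lemma chart_of_le (R : Quad) {u v : ℝ} (h : u ≤ v) :
    chart R (u, v) = (1 - v) • R 0 + u • R 2 + (v - u) • R 3 := by
  simp [chart, squareRep, Fin.sum_univ_four, h]

lemma chart_of_ge (R : Quad) {u v : ℝ} (h : v ≤ u) :
    chart R (u, v) = (1 - u) • R 0 + (u - v) • R 1 + v • R 2 := by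
  simp [chart, squareRep, Fin.sum_univ_four, h]

/-- A grid square either lies on one side of the diagonal, where `chart Q` is affine, or is cut by
it along its own diagonal, where both charts change their affine formula. -/
lemma chart_gridSquare (Q : Quad) {N : ℕ} (p : ℕ × ℕ) {u v : ℝ}
    (hu : u ∈ Set.Icc (0 : ℝ) 1) (hv : v ∈ Set.Icc (0 : ℝ) 1) :
    chart (gridSquare Q N p) (u, v) = chart Q ((p.1 + u) / N, (p.2 + v) / N) := by
  obtain ⟨a, b⟩ := p
  obtain ⟨hu0, hu1⟩ := hu
  obtain ⟨hv0, hv1⟩ := hv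
  have hN : (0 : ℝ) ≤ N := Nat.cast_nonneg _
  have e0 : gridSquare Q N (a, b) 0 = chart Q (a / N, b / N) := by simp [gridSquare, gridVertex]
  have e1 : gridSquare Q N (a, b) 1 = chart Q ((a + 1) / N, b / N) := by
    simp [gridSquare, gridVertex]
  have e2 : gridSquare Q N (a, b) 2 = chart Q ((a + 1) / N, (b + 1) / N) := by
    simp [gridSquare, gridVertex]
  have e3 : gridSquare Q N (a, b) 3 = chart Q (a / N, (b + 1) / N) := by
    simp [gridSquare, gridVertex]
  have le : ∀ {x y : ℝ}, x ≤ y → x / N ≤ y / N := fun h => div_le_div_of_nonneg_right h hN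
  rcases lt_trichotomy a b with h | rfl | h
  · have h : (a : ℝ) + 1 ≤ b := by exact_mod_cast h
    rw [chart_of_le Q (le (by linarith : (a : ℝ) + u ≤ b + v))]
    rcases le_total u v with h' | h'
    · rw [chart_of_le _ h', e0, e2, e3, chart_of_le Q (le (by linarith)),
        chart_of_le Q (le (by linarith)), chart_of_le Q (le (by linarith))]
      module
    · rw [chart_of_ge _ h', e0, e1, e2, chart_of_le Q (le (by linarith)),
        chart_of_le Q (le (by linarith)), chart_of_le Q (le (by linarith))]
      module
  · rcases le_total u v with h' | h'
    · rw [chart_of_le Q (le (by linarith : (a : ℝ) + u ≤ a + v)), chart_of_le _ h', e0, e2, e3,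
        chart_of_le Q le_rfl, chart_of_le Q le_rfl, chart_of_le Q (le (by linarith))]
      module
    · rw [chart_of_ge Q (le (by linarith : (a : ℝ) + v ≤ a + u)), chart_of_ge _ h', e0, e1, e2,
        chart_of_ge Q le_rfl, chart_of_ge Q le_rfl, chart_of_ge Q (le (by linarith))]
      module
  · have h : (b : ℝ) + 1 ≤ a := by exact_mod_cast h
    rw [chart_of_ge Q (le (by linarith : (b : ℝ) + v ≤ a + u))]
    rcases le_total u v with h' | h'
    · rw [chart_of_le _ h', e0, e2, e3, chart_of_ge Q (le (by linarith)),
        chart_of_ge Q (le (by linarith)), chart_of_ge Q (le (by linarith))]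
      module
    · rw [chart_of_ge _ h', e0, e1, e2, chart_of_ge Q (le (by linarith)),
        chart_of_ge Q (le (by linarith)), chart_of_ge Q (le (by linarith))]
      module

/-- The image of a grid square under `chart Q` lies in the convex hull of the images of its
vertices. -/
lemma chart_mem_region_gridSquare (Q : Quad) {N : ℕ} (hN : 0 < N) {p : ℕ × ℕ} {s : ℝ × ℝ}
    (h1 : (p.1 : ℝ) ≤ N * s.1 ∧ N * s.1 ≤ p.1 + 1) (h2 : (p.2 : ℝ) ≤ N * s.2 ∧ N * s.2 ≤ p.2 + 1) :
    chart Q s ∈ (gridSquare Q N p).region := by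
  have hN : (N : ℝ) ≠ 0 := by exact_mod_cast hN.ne'
  have hu : N * s.1 - p.1 ∈ Set.Icc (0 : ℝ) 1 := ⟨by linarith, by linarith⟩
  have hv : N * s.2 - p.2 ∈ Set.Icc (0 : ℝ) 1 := ⟨by linarith, by linarith⟩
  have e := chart_gridSquare Q (N := N) p hu hv
  rw [add_sub_cancel, add_sub_cancel, mul_div_cancel_left₀ _ hN, mul_div_cancel_left₀ _ hN] at e
  change _ = chart Q s at e
  rw [← e]
  exact sum_smul_mem_region _ (squareRep_nonneg ⟨hu, hv⟩) (sum_squareRep _)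

lemma gridVertex_le {m : ℕ} {p : ℕ × ℕ} (hp : p.1 < m ∧ p.2 < m) (i : Fin 4) :
    (gridVertex p i).1 ≤ m ∧ (gridVertex p i).2 ≤ m := by
  fin_cases i <;> simp [gridVertex] <;> omega

lemma div_mem_square {m : ℕ} {a : ℕ × ℕ} (h : a.1 ≤ m ∧ a.2 ≤ m) :
    ((a.1 / m : ℝ), (a.2 / m : ℝ)) ∈ Set.Icc (0 : ℝ) 1 ×ˢ Set.Icc (0 : ℝ) 1 := by
  have h1 : (a.1 : ℝ) ≤ m := by exact_mod_cast h.1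
  have h2 : (a.2 : ℝ) ≤ m := by exact_mod_cast h.2
  exact ⟨⟨by positivity, div_le_one_of_le₀ h1 (Nat.cast_nonneg _)⟩,
    ⟨by positivity, div_le_one_of_le₀ h2 (Nat.cast_nonneg _)⟩⟩

lemma chart_div_injective {Q : Quad} (hQ : IsConvexQuad Q) {m : ℕ} (hm : 0 < m) {a b : ℕ × ℕ}
    (ha : a.1 ≤ m ∧ a.2 ≤ m) (hb : b.1 ≤ m ∧ b.2 ≤ m)
    (h : chart Q (a.1 / m, a.2 / m) = chart Q (b.1 / m, b.2 / m)) : a = b := by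
  have e := congrArg (unchart Q) h
  rw [unchart_chart hQ (div_mem_square ha), unchart_chart hQ (div_mem_square hb)] at e
  have hm' : (m : ℝ) ≠ 0 := by exact_mod_cast hm.ne'
  simp only [Prod.mk.injEq, div_left_inj' hm', Nat.cast_inj] at e
  exact Prod.ext e.1 e.2

/-- The grid squares that correspond to the cells in `W`. -/
def pattern (Q : Quad) (m : ℕ) (W : Set Quad) : Set (ℕ × ℕ) :=
  {p | (p.1 < m ∧ p.2 < m) ∧ gridSquare Q m p ∈ W}

lemma gridSquare_subdivide {Q : Quad} (hQ : IsConvexQuad Q) {M m : ℕ} (v : ℕ × ℕ) {r : ℕ × ℕ}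
    (hr : r.1 < m ∧ r.2 < m) :
    gridSquare Q (M * m) (v.1 * m + r.1, v.2 * m + r.2) =
      fun i => P Q (gridSquare Q M v) (gridSquare Q m r i) := by
  have hm : (m : ℝ) ≠ 0 := by exact_mod_cast (by omega : m ≠ 0)
  ext1 i
  have hs := div_mem_square (gridVertex_le hr i)
  rw [gridSquare, gridSquare, P_chart hQ _ hs, chart_gridSquare Q v hs.1 hs.2]
  congr 2
  · simp only [gridVertex, Nat.cast_mul, Nat.cast_add]
    rw [mul_comm (M : ℝ), ← div_div]
    congr 1
    field_simp
    ring
  · simp only [gridVertex, Nat.cast_mul, Nat.cast_add]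
    rw [mul_comm (M : ℝ), ← div_div]
    congr 1
    field_simp
    ring

lemma gridSquare_mem_white {Q : Quad} (hQ : IsConvexQuad Q) {m : ℕ} {W : Set Quad} {n : ℕ}
    {p : ℕ × ℕ} (hp : p ∈ gridLevel m (pattern Q m W) n) :
    gridSquare Q (m ^ (n + 1)) p ∈ white Q W n := by
  induction n generalizing p with
  | zero => simpa [white] using hp.2
  | succ n ih =>
    obtain ⟨v, hv, r, hr, rfl⟩ := hp
    exact ⟨_, ih hv, _, hr.2, by rw [pow_succ, gridSquare_subdivide hQ v hr.1]⟩

lemma chart_mem_fractal {Q : Quad} (hQ : IsConvexQuad Q) {m : ℕ} (hm : 0 < m) {W : Set Quad}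
    {s : ℝ × ℝ} (hs : ∀ n, s ∈ gridRegion (m ^ (n + 1)) (gridLevel m (pattern Q m W) n)) :
    chart Q s ∈ fractal Q W := by
  refine Set.mem_iInter.2 fun n => ?_
  have := hs n
  simp only [gridRegion, Set.mem_iUnion] at this
  obtain ⟨p, hp, h1, h2⟩ := this
  exact Set.mem_biUnion (gridSquare_mem_white hQ hp)
    (chart_mem_region_gridSquare Q (by positivity) (by exact_mod_cast h1) (by exact_mod_cast h2))

lemma lt_of_mem_A {m : ℕ} {k : Fin 4 → ℕ} (hk : k ∈ A m) : k 1 + k 2 < m ∧ k 2 + k 3 < m := by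
  rcases hk with (⟨h1, h2, h3⟩ | ⟨h1, h2, h3⟩) | ⟨h1, h2, h3⟩ <;> omega

/-- The lower left corner comes from the coordinates `(α 1 + α 2, α 2 + α 3)` of the chart. Off the
diagonal the exceptional vertex in `cell` completes a parallelogram, as it must because `chart Q` is
affine on the whole grid square. -/
lemma cell_eq_gridSquare (Q : Quad) {m : ℕ} {k : Fin 4 → ℕ} (hk : k ∈ A m) :
    cell Q m k = gridSquare Q m (k 1 + k 2, k 2 + k 3) := by
  have hm' : (m : ℝ) ≠ 0 := by
    have := lt_of_mem_A hk
    exact_mod_cast (by omega : m ≠ 0)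
  have le : ∀ {x y : ℝ}, x ≤ y → x / m ≤ y / m :=
    fun h => div_le_div_of_nonneg_right h (Nat.cast_nonneg _)
  rcases hk with (⟨h1, h2, h3⟩ | ⟨h1, h2, h3⟩) | ⟨h1, h2, h3⟩
  · have hk1 : (1 : ℝ) ≤ k 1 := by exact_mod_cast Nat.one_le_iff_ne_zero.2 h3
    have e : (k 0 : ℝ) = m - 1 - k 1 - k 2 := by rw [← h1]; push_cast; ring
    ext1 i
    fin_cases i
    all_goals
      simp [cell, h2, h3, gridSquare, gridVertex, Fin.sum_univ_four]
      rw [chart_of_ge Q (le (by linarith)), e]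
      match_scalars <;> field_simp <;> ring
  · have hk3 : (1 : ℝ) ≤ k 3 := by exact_mod_cast Nat.one_le_iff_ne_zero.2 h3
    have e : (k 0 : ℝ) = m - 1 - k 2 - k 3 := by rw [← h1]; push_cast; ring
    ext1 i
    fin_cases i
    all_goals
      simp [cell, h2, h3, gridSquare, gridVertex, Fin.sum_univ_four]
      rw [chart_of_le Q (le (by linarith)), e]
      match_scalars <;> field_simp <;> ring
  · have e : (k 0 : ℝ) = m - 1 - k 2 := by rw [← h1]; push_cast; ring
    ext1 i
    fin_cases i
    all_goals
      simp [cell, h2, h3, gridSquare, gridVertex, Fin.sum_univ_four]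
      first
        | rw [chart_of_le Q (le (by linarith)), e]
        | rw [chart_of_ge Q (le (by linarith)), e]
      match_scalars <;> field_simp <;> ring

/-- The chart is injective on grid points, so a common side of the images comes from two common
vertices of the grid squares. -/
lemma sideAdj_of_sides {Q : Quad} (hQ : IsConvexQuad Q) {m : ℕ} {p q : ℕ × ℕ}
    (hp : p.1 < m ∧ p.2 < m) (hq : q.1 < m ∧ q.2 < m) (hpq : p ≠ q)
    (h : ((gridSquare Q m p).sides ∩ (gridSquare Q m q).sides).Nonempty) : SideAdj p q := by
  have hm : 0 < m := by omega
  obtain ⟨_, ⟨i, rfl⟩, j, hij⟩ := h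
  have inj : ∀ {i j}, gridSquare Q m p i = gridSquare Q m q j → gridVertex p i = gridVertex q j :=
    fun h => chart_div_injective hQ hm (gridVertex_le hp _) (gridVertex_le hq _) h
  have key : (gridVertex p i = gridVertex q j ∧ gridVertex p (i + 1) = gridVertex q (j + 1)) ∨
      (gridVertex p i = gridVertex q (j + 1) ∧ gridVertex p (i + 1) = gridVertex q j) := by
    rcases Sym2.eq_iff.1 hij with ⟨h1, h2⟩ | ⟨h1, h2⟩
    · exact .inl ⟨inj h1, inj h2⟩
    · exact .inr ⟨inj h1, inj h2⟩
  obtain ⟨a, b⟩ := p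
  obtain ⟨c, d⟩ := q
  simp only [ne_eq, Prod.mk.injEq] at hpq
  clear hij inj hp hq
  simp only [SideAdj]
  fin_cases i <;> fin_cases j <;> simp [gridVertex] at key <;> omega

lemma exists_gridSquare_of_mem {Q : Quad} {m : ℕ} {W : Set Quad} (hW : W ⊆ cells Q m) {U : Quad}
    (hU : U ∈ W) : ∃ p ∈ pattern Q m W, U = gridSquare Q m p := by
  obtain ⟨k, hk, rfl⟩ := hW hU
  rw [cell_eq_gridSquare Q hk] at hU ⊢
  exact ⟨_, ⟨lt_of_mem_A hk, hU⟩, rfl⟩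

lemma mem_pattern_of_cell {Q : Quad} {m : ℕ} {W : Set Quad} {k : Fin 4 → ℕ} (hk : k ∈ A m)
    (h : cell Q m k ∈ W) : (k 1 + k 2, k 2 + k 3) ∈ pattern Q m W :=
  ⟨lt_of_mem_A hk, by rwa [← cell_eq_gridSquare Q hk]⟩

lemma gridSquare_injOn {Q : Quad} (hQ : IsConvexQuad Q) {m : ℕ} {p q : ℕ × ℕ}
    (hp : p.1 < m ∧ p.2 < m) (hq : q.1 < m ∧ q.2 < m)
    (h : gridSquare Q m p = gridSquare Q m q) : p = q := by
  have := chart_div_injective hQ (by omega) (gridVertex_le hp 0) (gridVertex_le hq 0) (congrFun h 0)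
  simpa [gridVertex] using this

lemma linked_of_walk {Q : Quad} (hQ : IsConvexQuad Q) {m : ℕ} {W : Set Quad}
    (hW : W ⊆ cells Q m) {U V : W} (w : (whiteGraph W).Walk U V) {p q : ℕ × ℕ}
    (hp : p ∈ pattern Q m W) (hq : q ∈ pattern Q m W) (hU : U.1 = gridSquare Q m p)
    (hV : V.1 = gridSquare Q m q) : Linked (pattern Q m W) p q := by
  induction w generalizing p with
  | nil =>
    rw [gridSquare_injOn hQ hp.1 hq.1 (hU.symm.trans hV)]
    exact .refl
  | @cons U V' _ hadj _ ih =>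
    obtain ⟨r, hr, hV'⟩ := exists_gridSquare_of_mem hW V'.2
    refine (ih hr hV' hV).head ⟨hp, hr, sideAdj_of_sides hQ hp.1 hr.1 ?_ ?_⟩
    · rintro rfl
      exact hadj.1 (Subtype.ext (hU.trans hV'.symm))
    · rw [← hU, ← hV']
      exact hadj.2

lemma IsLabyrinthSet.isGridLabyrinth {Q : Quad} (hQ : IsConvexQuad Q) {m : ℕ} {W : Set Quad}
    (hW : IsLabyrinthSet Q m W) : IsGridLabyrinth m (pattern Q m W) where
  lt p hp := hp.1
  linked p hp q hq := by
    obtain ⟨w⟩ := hW.tree.connected.preconnected ⟨_, hp.2⟩ ⟨_, hq.2⟩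
    exact linked_of_walk hQ hW.subset_cells w hp hq rfl rfl
  exit_bottom_top := by
    -- The chart sends the bottom side of the square to the side from `Q 0` to `Q 1`, so the left
    -- and right exits of `W` become bottom and top exits of the pattern, both in column `b`.
    obtain ⟨⟨a, b⟩, ⟨hA, h1, h2⟩, -⟩ := hW.exit_left_right
    have hab : a + b + 1 = m ∧ ![0, 0, b, a] ∈ A m := by
      simp [A, A₁, A₂, A₃] at hA ⊢
      omega
    refine ⟨b, by simpa using mem_pattern_of_cell hA h1, ?_⟩
    simpa [show m - 1 = b + a by omega] using mem_pattern_of_cell hab.2 h2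
  exit_left_right := by
    obtain ⟨⟨a, b⟩, ⟨hA, h1, h2⟩, -⟩ := hW.exit_top_bottom
    have hab : a + b + 1 = m ∧ ![0, a, b, 0] ∈ A m := by
      simp [A, A₁, A₂, A₃] at hA ⊢
      omega
    refine ⟨b, by simpa using mem_pattern_of_cell hA h1, ?_⟩
    simpa [show m - 1 = a + b by omega] using mem_pattern_of_cell hab.2 h2

/-! ### Vertices outside the fractal -/

/-- The grid square at the vertex `i` of the `m × m` grid. -/
def cornerSquare (m : ℕ) : Fin 4 → ℕ × ℕ := ![(0, 0), (m - 1, 0), (m - 1, m - 1), (0, m - 1)]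

/-- `Q i` can be separated from the hull of any other cell: the affine function vanishing at its two
neighbours is positive at `Q i` and negative at the opposite vertex, so at a grid point it is at
most the `i`-th coefficient times its value at `Q i`. Hence some vertex of the cell has `i`-th
coefficient 1, which makes it `Q i`. -/
lemma eq_cornerSquare_of_mem_region {Q : Quad} (hQ : IsConvexQuad Q) {m : ℕ} {p : ℕ × ℕ}
    (hp : p.1 < m ∧ p.2 < m) {i : Fin 4} (h : Q i ∈ (gridSquare Q m p).region) :
    p = cornerSquare m i := by
  have hm : (0 : ℝ) < m := by exact_mod_cast (by omega : 0 < m)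
  obtain ⟨β, h0, h1, hβ⟩ := exists_of_mem_region h
  have hi : 0 < turn (Q (i + 1)) (Q (i + 3)) (Q i) := by
    have := hQ.left_turn (i + 3)
    rw [show i + 3 + 1 = i by fin_cases i <;> rfl, show i + 3 + 2 = i + 1 by fin_cases i <;> rfl]
      at this
    rwa [← turn_rotate]
  have hopp : turn (Q (i + 1)) (Q (i + 3)) (Q (i + 2)) < 0 := by
    have := hQ.left_turn (i + 1)
    rw [show i + 1 + 1 = i + 2 by fin_cases i <;> rfl,
      show i + 1 + 2 = i + 3 by fin_cases i <;> rfl] at this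
    rw [turn_swap]
    linarith
  set ℓ := turn (Q (i + 1)) (Q (i + 3)) with hℓ
  have hv : ∀ j, ℓ (gridSquare Q m p j) ≤ squareRep
      ((gridVertex p j).1 / m, (gridVertex p j).2 / m) i * ℓ (Q i) := by
    intro j
    have hn := squareRep_nonneg (div_mem_square (gridVertex_le hp j))
    rw [gridSquare, chart, hℓ, turn_sum _ _ _ (sum_squareRep _), ← hℓ]
    generalize squareRep _ = α at hn
    have e : ∑ k, α k * ℓ (Q k) = α i * ℓ (Q i) + α (i + 1) * ℓ (Q (i + 1)) +
        α (i + 2) * ℓ (Q (i + 2)) + α (i + 3) * ℓ (Q (i + 3)) := by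
      rw [Fin.sum_univ_four]
      fin_cases i <;> simp <;> ring
    rw [e, hℓ, turn_self, turn_self_right, ← hℓ]
    nlinarith [hn (i + 2)]
  obtain ⟨j, hj⟩ : ∃ j, 1 ≤ squareRep ((gridVertex p j).1 / m, (gridVertex p j).2 / m) i := by
    by_contra! hlt
    have e := turn_sum (Q (i + 1)) (Q (i + 3)) (gridSquare Q m p) h1
    rw [hβ, ← hℓ] at e
    have : ∑ j, β j * ℓ (gridSquare Q m p j) < ∑ j, β j * ℓ (Q i) := by
      obtain ⟨j, -, hj⟩ := Finset.exists_lt_of_sum_lt (s := Finset.univ) (f := fun _ => (0 : ℝ))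
        (g := β) (by rw [h1]; simp)
      refine Finset.sum_lt_sum (fun j _ => mul_le_mul_of_nonneg_left ?_ (h0 j))
        ⟨j, Finset.mem_univ _, mul_lt_mul_of_pos_left ?_ hj⟩
      · exact (hv j).trans (by nlinarith [hlt j])
      · exact (hv j).trans_lt (by nlinarith [hlt j])
    rw [← e, ← Finset.sum_mul, h1, one_mul] at this
    exact this.false
  obtain ⟨a, b⟩ := p
  obtain ⟨ha, hb⟩ := hp
  simp only at ha hb
  have hcorner : gridVertex (a, b) j = (![0, m, m, 0] i, ![0, 0, m, m] i) := by
    obtain ⟨hle1, hle2⟩ := gridVertex_le (p := (a, b)) ⟨ha, hb⟩ j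
    generalize gridVertex (a, b) j = v at hj hle1 hle2
    obtain ⟨c, d⟩ := v
    simp only at hj hle1 hle2
    have hc0 : 0 ≤ (c / m : ℝ) := by positivity
    have hd0 : 0 ≤ (d / m : ℝ) := by positivity
    have low : ∀ {c : ℕ}, (c / m : ℝ) ≤ 0 → c = 0 := by
      intro c h
      rw [div_le_iff₀ hm, zero_mul] at h
      exact_mod_cast le_antisymm h (Nat.cast_nonneg _)
    have high : ∀ {c : ℕ}, c ≤ m → 1 ≤ (c / m : ℝ) → c = m := by
      intro c hc h
      rw [le_div_iff₀ hm, one_mul] at h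
      exact le_antisymm hc (by exact_mod_cast h)
    have le1 : ∀ {c : ℕ}, c ≤ m → (c / m : ℝ) ≤ 1 := fun h =>
      div_le_one_of_le₀ (by exact_mod_cast h) hm.le
    fin_cases i
    · have hmax : max (c / m : ℝ) (d / m) ≤ 0 := by
        simp only [squareRep, Fin.zero_eta, Matrix.cons_val] at hj
        linarith
      exact Prod.ext (low ((le_max_left _ _).trans hmax)) (low ((le_max_right _ _).trans hmax))
    · have h : (1 : ℝ) ≤ c / m - d / m := by
        simp only [squareRep, Fin.mk_one, Matrix.cons_val, le_max_iff] at hj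
        rcases hj with hj | hj <;> linarith
      exact Prod.ext (high hle1 (by linarith)) (low (by linarith [le1 hle1]))
    · have h : (1 : ℝ) ≤ min (c / m : ℝ) (d / m) := hj
      rw [le_min_iff] at h
      exact Prod.ext (high hle1 h.1) (high hle2 h.2)
    · have h : (1 : ℝ) ≤ d / m - c / m := by
        have hj : (1 : ℝ) ≤ max (d / m - c / m : ℝ) 0 := hj
        rw [le_max_iff] at hj
        rcases hj with hj | hj <;> linarith
      exact Prod.ext (low (by linarith [le1 hle2])) (high hle2 (by linarith))
  clear hj hv
  fin_cases i <;> fin_cases j <;> simp [gridVertex, cornerSquare] at hcorner ⊢ <;> omega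

lemma cornerSquare_mem_of_mem_fractal {Q : Quad} (hQ : IsConvexQuad Q) {m : ℕ} {W : Set Quad}
    (hW : W ⊆ cells Q m) {i : Fin 4} (h : Q i ∈ fractal Q W) :
    gridSquare Q m (cornerSquare m i) ∈ W := by
  have h0 := Set.mem_iInter.1 h 0
  simp only [level, white, Set.mem_iUnion] at h0
  obtain ⟨U, hU, hi⟩ := h0
  obtain ⟨p, hp, rfl⟩ := exists_gridSquare_of_mem hW hU
  rwa [← eq_cornerSquare_of_mem_region hQ hp.1 hi]

/-- The first level suffices: a vertex in the fractal forces its corner cell into `W`, and the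
corner property forbids two opposite ones. -/
lemma IsLabyrinthSet.notMem_fractal {Q : Quad} (hQ : IsConvexQuad Q) {m : ℕ} {W : Set Quad}
    (hW : IsLabyrinthSet Q m W) :
    (Q 0 ∉ fractal Q W ∨ Q 2 ∉ fractal Q W) ∧ (Q 1 ∉ fractal Q W ∨ Q 3 ∉ fractal Q W) := by
  have hm := hW.four_le
  have key : ∀ {i : Fin 4} {k : Fin 4 → ℕ}, k ∈ A m → (k 1 + k 2, k 2 + k 3) = cornerSquare m i →
      Q i ∈ fractal Q W → cell Q m k ∈ W := by
    intro i k hk hki hi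
    rw [cell_eq_gridSquare Q hk, hki]
    exact cornerSquare_mem_of_mem_fractal hQ hW.subset_cells hi
  constructor
  · by_contra! h
    refine hW.corner₁₃ ⟨key ?_ ?_ h.1, key ?_ ?_ h.2⟩ <;> simp [A, A₁, A₂, A₃, cornerSquare] <;> omega
  · by_contra! h
    refine hW.corner₂₄ ⟨key ?_ ?_ h.1, key ?_ ?_ h.2⟩ <;> simp [A, A₁, A₂, A₃, cornerSquare] <;> omega

lemma vertex_mem_region (R : Quad) (i : Fin 4) : R i ∈ R.region :=
  subset_convexHull ℝ _ (Set.mem_range_self i)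

lemma unchart_vertex {Q : Quad} (hQ : IsConvexQuad Q) (i : Fin 4) :
    unchart Q (Q i) = (![0, 1, 1, 0] i, ![0, 0, 1, 1] i) := by
  have h : IsRep Q (Q i) (Pi.single i 1) := by
    refine ⟨fun j => ?_, by simp, ?_, ?_⟩
    · by_cases h : j = i
      · simp [h]
      · simp [h]
    · simp [Pi.single_apply, ite_smul]
    · fin_cases i <;> simp
  rw [h.unchart_eq hQ]
  fin_cases i <;> simp

/-! ### Separation of neighbouring vertices -/

/-- Two points at which one of the coordinates of the chart is `0` and `1`, respectively, are
not joined by a path in the complement of the fractal. -/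
lemma IsLabyrinthSet.not_joinedIn {Q : Quad} (hQ : IsConvexQuad Q) {m : ℕ} {W : Set Quad}
    (hW : IsLabyrinthSet Q m W) {x y : Plane}
    (h : ((unchart Q x).1 = 0 ∧ (unchart Q y).1 = 1) ∨ (unchart Q x).2 = 0 ∧ (unchart Q y).2 = 1) :
    ¬ JoinedIn (Q.region \ fractal Q W) x y := by
  rintro ⟨γ, hγ⟩
  have hm : 0 < m := by linarith [hW.four_le]
  have hS := hW.isGridLabyrinth hQ
  have hf : Continuous fun t => unchart Q (γ t) := (continuous_unchart Q).comp γ.continuous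
  have hmem : ∀ t, unchart Q (γ t) ∈ Set.Icc (0 : ℝ) 1 ×ˢ Set.Icc (0 : ℝ) 1 := fun t =>
    have ⟨_, hα⟩ := exists_isRep hQ (hγ t).1
    hα.unchart_mem hQ
  obtain ⟨t, ht⟩ : ∃ t, ∀ n, unchart Q (γ t) ∈
      gridRegion (m ^ (n + 1)) (gridLevel m (pattern Q m W) n) := by
    rcases h with ⟨h0, h1⟩ | ⟨h0, h1⟩
    · exact hS.exists_forall_mem_gridRegion hf hmem (by simpa using h0) (by simpa using h1)
    · exact hS.exists_forall_mem_gridRegion_of_snd hf hmem (by simpa using h0) (by simpa using h1)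
  have := chart_mem_fractal hQ hm ht
  obtain ⟨α, hα⟩ := exists_isRep hQ (hγ t).1
  rw [hα.chart_unchart hQ] at this
  exact (hγ t).2 this

end QuadLabyrinth

theorem theorem4p3 (Q : QuadLabyrinth.Quad) (hQ : QuadLabyrinth.IsConvexQuad Q)
    (m : ℕ) (W : Set QuadLabyrinth.Quad) (hW : QuadLabyrinth.IsLabyrinthSet Q m W) :
    (Q.region \ QuadLabyrinth.fractal Q W).Nonempty ∧
      ¬ IsPathConnected (Q.region \ QuadLabyrinth.fractal Q W) := by
  obtain ⟨h02, h13⟩ := hW.notMem_fractal hQ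
  have mem : ∀ {i}, Q i ∉ QuadLabyrinth.fractal Q W →
      Q i ∈ Q.region \ QuadLabyrinth.fractal Q W :=
    fun h => ⟨QuadLabyrinth.vertex_mem_region Q _, h⟩
  refine ⟨h02.elim (fun h => ⟨_, mem h⟩) (fun h => ⟨_, mem h⟩), fun hpc => ?_⟩
  rw [isPathConnected_iff] at hpc
  have joined := hpc.2
  -- Each case is a side of `Q`, oriented so that the coordinate which changes along it goes from 0
  -- to 1.
  rcases h02 with h | h <;> rcases h13 with h' | h'
  · refine hW.not_joinedIn hQ (.inl ?_) (joined _ (mem h) _ (mem h'))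
    simp [QuadLabyrinth.unchart_vertex hQ]
  · refine hW.not_joinedIn hQ (.inr ?_) (joined _ (mem h) _ (mem h'))
    simp [QuadLabyrinth.unchart_vertex hQ]
  · refine hW.not_joinedIn hQ (.inr ?_) (joined _ (mem h') _ (mem h))
    simp [QuadLabyrinth.unchart_vertex hQ]
  · refine hW.not_joinedIn hQ (.inl ?_) (joined _ (mem h') _ (mem h))
    simp [QuadLabyrinth.unchart_vertex hQ]
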